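/- **Setting.** Let $1\le M\le K$, with players $p_1,\dots,p_M$ and arms $a_1,\dots,a_K$. Fix a single-parameter exponential family on $\mathbb R$ with densities $x\mapsto e^{\theta x-b(\theta)}$, $\theta\in\Theta$, with respect to a reference measure $\rho$ not carried by a single point, where $b(\theta)=\log\int e^{\theta x}\,d\rho(x)$ and $\Theta\subseteq\mathbb R$ is contained in the interior of $\{\theta:\int e^{\theta x}d\rho(x)<\infty\}$. Its members are parametrised by their means $\mu=b'(\theta)$, $\theta=\theta_\mu\in\Theta$; write $d(\mu_1,\mu_2)=(\theta_{\mu_1}-\theta_{\mu_2})\mu_1-b(\theta_{\mu_1})+b(\theta_{\mu_2})$ for the Kullback–Leibler divergence. A market instance is a pair $(\mu,\eta)$ of $M\times K$ matrices of means of the family: $p_i$ prefers $a_k$ to $a_l$ iff $\mu^{(i)}_k>\mu^{(i)}_l$, and $a_k$ prefers $p_i$ to $p_j$ iff $\eta^{(i)}_k>\eta^{(j)}_k$. A matching is an injective map $m$ from players to arms (a bijection if $M=K$). It is stable if there is no blocking pair, i.e. no $(p_i,a_k)$ with $a_k\ne m(p_i)$ such that $p_i$ prefers $a_k$ to $m(p_i)$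 and $a_k$ is either unmatched or prefers $p_i$ to its match. Let $\mathcal S_2$ be the set of instances with exactly one stable matching, and for a matching $m$ let $\neg m$ be the set of all instances $(\lambda,\nu)$ in which $m$ is not stable. In each round an algorithm chooses, as a function of the past observations and possibly of private randomness, a pair $(p_i,a_k)$, and observes $X\sim$ the law of the family with mean $\mu^{(i)}_k$ and $Y\sim$ the law with mean $\eta^{(i)}_k$, all rewards being independent. It stops at a stopping time $\tau_\delta\in\mathbb N\cup\{\infty\}$ of the history and then announces a matching. It is $\delta$-correct if, for every instance (not only those in $\mathcal S_2$) and every $\delta\in(0,1)$, the version of the algorithm run with confidence parameter $\delta$ announces a matching that is not stable in that instance with probability at most $\delta$. **Theorem.** Let $(\mu,\eta)\in\mathcal S_2$ with unique stable matching $m$, and let $$D(\mu,\eta)=\max_{w\in\Delta}\ \inf_{(\lambda,\nu)\in\neg m}\ \sum_{i=1}^{M}\sum_{k=1}^{K} w^{(i)}_k\Big[d(\mu^{(i)}_k,\lambda^{(i)}_k)+d(\eta^{(i)}_k,\nu^{(i)}_k)\Big],$$ where $\Delta=\{w\in[0,\infty)^{M\times K}:\sum_{i,k}w^{(i)}_k=1\}$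 (with $\inf\emptyset=\infty$). The maximum is attained, and every $\delta$-correct algorithm satisfies $$\liminf_{\delta\to0}\frac{\mathbb E_{\mu,\eta}[\tau_\delta]}{\log(1/\delta)}\ \ge\ T^\star(\mu,\eta):=D(\mu,\eta)^{-1},$$ with the conventions $1/\infty=0$ and $1/0=\infty$. -/

import Mathlib

open MeasureTheory ProbabilityTheory Filter Topology
open scoped ENNReal

noncomputable section

/-- A single-parameter exponential family on `ℝ`: the densities `x ↦ exp (θ x - b θ)`, `θ ∈ Θ`,
with respect to a reference measure `ref`, where `b θ = log ∫ exp (θ x) d ref(x)`.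
The parameters lie in the interior of the natural parameter space (so that `b` is differentiable
on `Θ`), and `ref` is not carried by a single point (so that `θ ↦ b' θ` is injective on `Θ`). -/
structure ExpFamily where
  ref : Measure ℝ
  Θ : Set ℝ
  Θ_subset : Θ ⊆ interior (integrableExpSet id ref)
  nondegenerate : ∀ c : ℝ, ¬ ∀ᵐ x ∂ref, x = c

namespace ExpFamily

variable (F : ExpFamily)

/-- The log-partition function `b θ = log ∫ exp (θ x) d ref(x)`. -/
def b (θ : ℝ) : ℝ := cgf id F.ref θ

/-- The possible mean rewards: the values `b' θ`, `θ ∈ Θ`. -/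
def Mean : Type := {x : ℝ // ∃ θ ∈ F.Θ, deriv F.b θ = x}

variable {F}

/-- The parameter `θ_μ ∈ Θ` with `b' θ_μ = μ`. -/
def Mean.param (x : F.Mean) : ℝ := x.2.choose

/-- The reward distribution of the family with mean `μ`. -/
def law (x : F.Mean) : Measure ℝ :=
  F.ref.withDensity (fun y => ENNReal.ofReal (Real.exp (x.param * y - F.b x.param)))

/-- The Kullback-Leibler divergence between the members of the family with means `μ₁` and `μ₂`:
`d μ₁ μ₂ = (θ_{μ₁} - θ_{μ₂}) μ₁ - b θ_{μ₁} + b θ_{μ₂}`. -/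
def d (x y : F.Mean) : ℝ :=
  (x.param - y.param) * x.1 - F.b x.param + F.b y.param

theorem Mean.param_mem (x : F.Mean) : x.param ∈ F.Θ := x.2.choose_spec.1

theorem Mean.deriv_param (x : F.Mean) : deriv F.b x.param = x.1 := x.2.choose_spec.2

theorem Mean.integrable_exp (x : F.Mean) :
    Integrable (fun y : ℝ => Real.exp (x.param * id y)) F.ref :=
  integrable_of_mem_integrableExpSet (interior_subset (F.Θ_subset x.param_mem))

theorem law_eq_tilted (x : F.Mean) :
    law x = F.ref.tilted (fun y => x.param * id y) := by
  have hne : NeZero F.ref := ⟨fun h => F.nondegenerate 0 (by simp [h])⟩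
  unfold law Measure.tilted b
  congr 1
  funext y
  rw [Real.exp_sub, exp_cgf x.integrable_exp]
  rfl

instance (x : F.Mean) : IsProbabilityMeasure (law x) := by
  have hne : NeZero F.ref := ⟨fun h => F.nondegenerate 0 (by simp [h])⟩
  rw [law_eq_tilted]
  exact isProbabilityMeasure_tilted x.integrable_exp

/-- The distribution `law x` indeed has mean `x`. -/
theorem integral_law (x : F.Mean) : ∫ y, y ∂(law x) = x.1 := by
  rw [law_eq_tilted, ← x.deriv_param]
  exact integral_tilted_mul_self (X := id) (F.Θ_subset x.param_mem)

end ExpFamily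

/-- A two-sided market with players `Fin M` and arms `Fin K`: `mu i k` is the mean reward that
player `i` gets from arm `k`, and `eta i k` the mean reward that arm `k` gets from player `i`.
Each agent prefers the agents of the other side that give it a larger mean reward. -/
structure Market (F : ExpFamily) (M K : ℕ) where
  mu : Fin M → Fin K → F.Mean
  eta : Fin M → Fin K → F.Mean

namespace Market

variable {F : ExpFamily} {M K : ℕ}

/-- `(i, k)` blocks `m`: `k ≠ m i`, player `i` strictly prefers `k` to its match `m i`, and arm `k`
strictly prefers `i` to its match (if `k` is unmatched, it accepts every player). -/
def Blocks (ζ : Market F M K) (m : Fin M → Fin K) (i : Fin M) (k : Fin K) : Prop :=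
  k ≠ m i ∧ (ζ.mu i (m i)).1 < (ζ.mu i k).1 ∧ ∀ j, m j = k → (ζ.eta j k).1 < (ζ.eta i k).1

/-- `m` is a stable matching of the market. -/
def IsStable (ζ : Market F M K) (m : Fin M → Fin K) : Prop :=
  Function.Injective m ∧ ∀ i k, ¬ ζ.Blocks m i k

/-- `m` is the unique stable matching of the market. -/
def IsUniqueStable (ζ : Market F M K) (m : Fin M → Fin K) : Prop :=
  ζ.IsStable m ∧ ∀ m', ζ.IsStable m' → m' = m

/-- The alternative set `¬m`: the markets in which `m` is not stable. -/
def alternatives (F : ExpFamily) (m : Fin M → Fin K) : Set (Market F M K) :=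
  {ζ' | ¬ ζ'.IsStable m}

/-- `inf_{(λ,ν) ∈ ¬m} ∑_{i,k} w_{ik} (d(μ_{ik}, λ_{ik}) + d(η_{ik}, ν_{ik}))`, in `[0, ∞]`
(it is `∞` if `¬m` is empty). -/
def info (ζ : Market F M K) (m : Fin M → Fin K) (w : Fin M × Fin K → ℝ) : ℝ≥0∞ :=
  ⨅ ζ' ∈ alternatives F m, ENNReal.ofReal (∑ i, ∑ k,
    w (i, k) * (ExpFamily.d (ζ.mu i k) (ζ'.mu i k) + ExpFamily.d (ζ.eta i k) (ζ'.eta i k)))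

/-- `D(μ,η)`, the supremum of `info` over the simplex of sampling proportions. -/
def D (ζ : Market F M K) (m : Fin M → Fin K) : ℝ≥0∞ :=
  ⨆ w ∈ stdSimplex ℝ (Fin M × Fin K), ζ.info m w

/-- `T⋆(μ,η) = D(μ,η)⁻¹`. -/
def Tstar (ζ : Market F M K) (m : Fin M → Fin K) : ℝ≥0∞ := (ζ.D m)⁻¹

end Market

/-- What is observed in one round: the matched pair `(i, k)` and the two rewards `(X, Y)`. -/
abbrev Obs (M K : ℕ) : Type := (Fin M × Fin K) × (ℝ × ℝ)

/-- A possibly randomized sequential algorithm: a private random seed with law `seedLaw`; after `n`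
rounds, a decision whether to stop, the matching announced if it stops, and the pair matched next
otherwise, all of them measurable functions of the seed and of the first `n` observations. -/
structure Algorithm (M K : ℕ) where
  seedLaw : Measure ℝ
  isProb : IsProbabilityMeasure seedLaw
  sample : (n : ℕ) → ℝ × (Fin n → Obs M K) → Fin M × Fin K
  measurable_sample : ∀ n, Measurable (sample n)
  halt : (n : ℕ) → Set (ℝ × (Fin n → Obs M K))
  measurableSet_halt : ∀ n, MeasurableSet (halt n)
  announce : (n : ℕ) → ℝ × (Fin n → Obs M K) → (Fin M → Fin K)
  measurable_announce : ∀ n, Measurable (announce n)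

/-- The sample space: the seed, and for each round `t` and each pair `q` the rewards `(X, Y)` that
are received if `q` is matched in round `t`. -/
abbrev Outcome (M K : ℕ) : Type := ℝ × (ℕ → Fin M × Fin K → ℝ × ℝ)

namespace Algorithm

variable {F : ExpFamily} {M K : ℕ}

/-- The first `n` observations. -/
def history (A : Algorithm M K) (ω : Outcome M K) : (n : ℕ) → Fin n → Obs M K
  | 0 => Fin.elim0
  | n + 1 => Fin.snoc (α := fun _ => Obs M K) (A.history ω n)
      (A.sample n (ω.1, A.history ω n), ω.2 n (A.sample n (ω.1, A.history ω n)))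

/-- The stopping time `τ`: the number of rounds played, `∞` if the algorithm never stops. -/
def tau (A : Algorithm M K) (ω : Outcome M K) : ℕ∞ :=
  ⨅ (n : ℕ) (_ : (ω.1, A.history ω n) ∈ A.halt n), (n : ℕ∞)

/-- The probability measure `P_{μ,η}`: the seed and all rewards are independent, the rewards
`X`, `Y` of the pair `(i, k)` having the laws of the family with means `mu i k`, `eta i k`. -/
def prob (A : Algorithm M K) (ζ : Market F M K) : Measure (Outcome M K) :=
  A.seedLaw.prod (Measure.infinitePi fun _ : ℕ => Measure.pi fun q : Fin M × Fin K =>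
    (ExpFamily.law (ζ.mu q.1 q.2)).prod (ExpFamily.law (ζ.eta q.1 q.2)))

/-- `E_{μ,η}[τ]`. -/
def expectedTau (A : Algorithm M K) (ζ : Market F M K) : ℝ≥0∞ :=
  ∫⁻ ω, (A.tau ω : ℝ≥0∞) ∂(A.prob ζ)

/-- `δ`-correctness at level `δ`: in every market, with one or several stable matchings, the
probability of stopping and announcing a matching that is not stable is at most `δ`. -/
def IsCorrect (A : Algorithm M K) (F : ExpFamily) (δ : ℝ) : Prop :=
  ∀ ζ : Market F M K,
    A.prob ζ {ω | ∃ n : ℕ, A.tau ω = n ∧ ¬ ζ.IsStable (A.announce n (ω.1, A.history ω n))}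
      ≤ ENNReal.ofReal δ

end Algorithm

end

/-! The proof is a change of measure. Fix an alternative `ζ'` in `¬m`. If `E[τ]` is finite under
`ζ`, the algorithm announces `m` with probability at least `1 - δ`, because no other matching is
stable there; under `ζ'` it does so with probability at most `δ`. Let `E` be the event of announcing
`m` before the horizon `n`, and `L` the log-likelihood ratio of the rounds played up to `min(τ, n)`.
Then `E_ζ[exp(-L)(1 + 1_E/δ)] = 1 + P_ζ'(E)/δ ≤ 2`, and Jensen's inequality yields `P_ζ(E) log(1/δ)
- log 2 ≤ E_ζ[L]` (`log_le_sum_playProb`).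

By independence `E_ζ[L]` is the sum over pairs of the expected number of plays times the divergence
of the pair (`integral_stoppedLlr`). The play counts do not depend on `ζ'`; once normalised they
form a point of the simplex, so the bound over all alternatives gives at most `E[τ] · D`
(`le_sum_mul_D`). Then `n → ∞`, followed by `δ → 0`. Truncation at `n` keeps every sum finite, so no
optional stopping theorem is needed.

The maximum is attained because an infimum of continuous functions is upper semicontinuous and the
simplex is compact. -/

noncomputable section

/-! ### Independence of a round from its past. -/

/-- A function of the seed and of the first `n` rounds is independent of round `n`. -/
theorem map_prodMk_eval_of_past {Ω R β : Type*} [MeasurableSpace Ω] [MeasurableSpace R]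
    [MeasurableSpace β] [Inhabited R] (P : Measure Ω) [IsProbabilityMeasure P] (ν : Measure R)
    [IsProbabilityMeasure ν] (n : ℕ) (f : Ω × (ℕ → R) → β) (hf : Measurable f)
    (hpast : ∀ s y y', (∀ t < n, y t = y' t) → f (s, y) = f (s, y')) :
    (P.prod (Measure.infinitePi fun _ : ℕ => ν)).map (fun ω => (f ω, ω.2 n)) =
      ((P.prod (Measure.infinitePi fun _ : ℕ => ν)).map f).prod ν := by
  set μ := Measure.infinitePi fun _ : ℕ => ν
  have hmeas : Measurable fun ω : Ω × (ℕ → R) => (f ω, ω.2 n) := by fun_prop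
  have : IsProbabilityMeasure ((P.prod μ).map f) := Measure.isProbabilityMeasure_map hf.aemeasurable
  refine (Measure.prod_eq fun A B hA hB => ?_).symm
  rw [Measure.map_apply hmeas (hA.prod hB), Measure.map_apply hf hA,
    Measure.prod_apply (hmeas (hA.prod hB)), Measure.prod_apply (hf hA),
    ← lintegral_mul_const _ (measurable_measure_prodMk_left (hf hA))]
  refine lintegral_congr fun s => ?_
  have hind : iIndepFun (fun (t : ℕ) (y : ℕ → R) => y t) μ :=
    iIndepFun_infinitePi (P := fun _ : ℕ => ν) (X := fun _ => id) fun _ => measurable_id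
  have h2 := hind.indepFun_finset (Finset.range n) {n} (by simp) fun t => measurable_pi_apply t
  -- The default values from coordinate `n` on are harmless: by `hpast`, `f` does not see them.
  let ext : (Finset.range n → R) → ℕ → R := fun y t =>
    if h : t ∈ Finset.range n then y ⟨t, h⟩ else default
  have hext : Measurable ext := by
    refine measurable_pi_iff.2 fun t => ?_
    by_cases h : t ∈ Finset.range n
    · simp only [ext, dif_pos h]
      fun_prop
    · simp only [ext, dif_neg h]
      fun_prop
  have hn : Measurable fun y : (({n} : Finset ℕ) → R) => y ⟨n, Finset.mem_singleton_self n⟩ :=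
    measurable_pi_apply (X := fun _ : ({n} : Finset ℕ) => R) _
  have h3 := h2.comp (φ := fun y => f (s, ext y))
    (ψ := fun y : (({n} : Finset ℕ) → R) => y ⟨n, Finset.mem_singleton_self n⟩)
    (hf.comp (measurable_const.prodMk hext)) hn
  have h4 := h3.measure_inter_preimage_eq_mul A B hA hB
  have e1 : ((fun y => f (s, ext y)) ∘ fun (y : ℕ → R) (i : Finset.range n) => y i) =
      fun y => f (s, y) := by
    funext y
    refine hpast _ _ _ fun t ht => ?_
    simp [ext, ht]
  rw [e1] at h4
  have h5 : μ {y | y n ∈ B} = ν B :=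
    (measurePreserving_eval_infinitePi (fun _ : ℕ => ν) n).measure_preimage hB.nullMeasurableSet
  rw [← h5]
  exact h4

/-! ### Likelihood ratios in the exponential family. -/

namespace ExpFamily

variable {F : ExpFamily}

/-- The log-likelihood ratio of one reward between the members with means `x` and `y`. -/
def llr (x y : F.Mean) (a : ℝ) : ℝ :=
  (x.param - y.param) * a - F.b x.param + F.b y.param

theorem measurable_llr (x y : F.Mean) : Measurable (llr x y) := by
  unfold llr; fun_prop

theorem law_eq_withDensity_llr (x y : F.Mean) :
    law y = (law x).withDensity fun a => ENNReal.ofReal (Real.exp (-llr x y a)) := by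
  unfold law
  rw [← withDensity_mul _ (by fun_prop) (by have := measurable_llr x y; fun_prop)]
  congr 1
  funext a
  rw [Pi.mul_apply, ← ENNReal.ofReal_mul (Real.exp_pos _).le, ← Real.exp_add]
  congr 2
  unfold llr
  ring

/-- The parameter is interior to the natural parameter space, so the tilted law has all moments. -/
theorem integrable_id_law (x : F.Mean) : Integrable (fun a : ℝ => a) (law x) := by
  have h := memLp_tilted_mul (X := id) (F.Θ_subset x.param_mem) 1
  rw [law_eq_tilted]
  exact memLp_one_iff_integrable.1 (by exact_mod_cast h)

theorem integrable_llr (x y : F.Mean) : Integrable (llr x y) (law x) :=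
  (((integrable_id_law x).const_mul _).sub (integrable_const _)).add (integrable_const _)

theorem integral_llr (x y : F.Mean) : ∫ a, llr x y a ∂(law x) = d x y := by
  have h := integrable_id_law x
  have e : llr x y = fun a => (x.param - y.param) * a + (- F.b x.param + F.b y.param) := by
    funext a; unfold llr; ring
  rw [e, integral_add (h.const_mul _) (integrable_const _), integral_const_mul, integral_law]
  simp [d]
  ring

end ExpFamily

/-! ### Likelihood ratio of the two rewards of a pair. -/

namespace Market

variable {F : ExpFamily} {M K : ℕ}

/-- The law of the two rewards of a pair. -/
def pairLaw (ζ : Market F M K) (q : Fin M × Fin K) : Measure (ℝ × ℝ) :=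
  (ExpFamily.law (ζ.mu q.1 q.2)).prod (ExpFamily.law (ζ.eta q.1 q.2))

instance (ζ : Market F M K) (q : Fin M × Fin K) : IsProbabilityMeasure (ζ.pairLaw q) := by
  unfold pairLaw; infer_instance

/-- The log-likelihood ratio of the two rewards of a pair. -/
def pairLlr (ζ ζ' : Market F M K) (q : Fin M × Fin K) (z : ℝ × ℝ) : ℝ :=
  ExpFamily.llr (ζ.mu q.1 q.2) (ζ'.mu q.1 q.2) z.1 +
    ExpFamily.llr (ζ.eta q.1 q.2) (ζ'.eta q.1 q.2) z.2

/-- The divergence between the laws of the rewards of a pair. -/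
def pairDiv (ζ ζ' : Market F M K) (q : Fin M × Fin K) : ℝ :=
  ExpFamily.d (ζ.mu q.1 q.2) (ζ'.mu q.1 q.2) + ExpFamily.d (ζ.eta q.1 q.2) (ζ'.eta q.1 q.2)

variable (ζ ζ' : Market F M K) (q : Fin M × Fin K)

@[fun_prop]
theorem measurable_pairLlr : Measurable (ζ.pairLlr ζ' q) :=
  ((ExpFamily.measurable_llr _ _).comp measurable_fst).add
    ((ExpFamily.measurable_llr _ _).comp measurable_snd)

theorem integrable_pairLlr : Integrable (ζ.pairLlr ζ' q) (ζ.pairLaw q) :=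
  ((ExpFamily.integrable_llr _ _).comp_fst _).add ((ExpFamily.integrable_llr _ _).comp_snd _)

theorem integral_pairLlr : ∫ z, ζ.pairLlr ζ' q z ∂(ζ.pairLaw q) = ζ.pairDiv ζ' q := by
  unfold pairLlr pairLaw pairDiv
  rw [integral_add ((ExpFamily.integrable_llr _ _).comp_fst _)
    ((ExpFamily.integrable_llr _ _).comp_snd _), ← ExpFamily.integral_llr,
    ← ExpFamily.integral_llr]
  congr 1
  · simpa using integral_prod_mul (μ := ExpFamily.law (ζ.mu q.1 q.2))
      (ν := ExpFamily.law (ζ.eta q.1 q.2))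
      (ExpFamily.llr (ζ.mu q.1 q.2) (ζ'.mu q.1 q.2)) (fun _ => (1 : ℝ))
  · simpa using integral_prod_mul (μ := ExpFamily.law (ζ.mu q.1 q.2))
      (ν := ExpFamily.law (ζ.eta q.1 q.2)) (fun _ => (1 : ℝ))
      (ExpFamily.llr (ζ.eta q.1 q.2) (ζ'.eta q.1 q.2))

theorem pairLaw_eq_withDensity :
    ζ'.pairLaw q =
      (ζ.pairLaw q).withDensity fun z => ENNReal.ofReal (Real.exp (-ζ.pairLlr ζ' q z)) := by
  have h1 := ExpFamily.measurable_llr (ζ.mu q.1 q.2) (ζ'.mu q.1 q.2)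
  have h2 := ExpFamily.measurable_llr (ζ.eta q.1 q.2) (ζ'.eta q.1 q.2)
  unfold pairLaw
  rw [ExpFamily.law_eq_withDensity_llr (ζ.mu q.1 q.2) (ζ'.mu q.1 q.2),
    ExpFamily.law_eq_withDensity_llr (ζ.eta q.1 q.2) (ζ'.eta q.1 q.2),
    prod_withDensity (by fun_prop) (by fun_prop)]
  congr 1
  funext z
  rw [← ENNReal.ofReal_mul (Real.exp_pos _).le, ← Real.exp_add, pairLlr, neg_add]

theorem lintegral_pairLaw (g : ℝ × ℝ → ℝ≥0∞) (hg : Measurable g) :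
    ∫⁻ z, g z ∂(ζ'.pairLaw q) =
      ∫⁻ z, g z * ENNReal.ofReal (Real.exp (-ζ.pairLlr ζ' q z)) ∂(ζ.pairLaw q) := by
  rw [ζ.pairLaw_eq_withDensity ζ' q, lintegral_withDensity_eq_lintegral_mul _ (by fun_prop) hg]
  simp [mul_comm]

end Market

/-! ### Change of measure after a fixed number of rounds. -/

namespace Algorithm

variable {F : ExpFamily} {M K : ℕ} (A : Algorithm M K)

instance (ζ : Market F M K) : IsProbabilityMeasure (A.prob ζ) := by
  have := A.isProb
  unfold prob; infer_instance

/-- The seed and the first `n` observations. -/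
def state (n : ℕ) (ω : Outcome M K) : ℝ × (Fin n → Obs M K) := (ω.1, A.history ω n)

theorem history_succ (ω : Outcome M K) (n : ℕ) :
    A.history ω (n + 1) = Fin.snoc (α := fun _ => Obs M K) (A.history ω n)
      (A.sample n (A.state n ω), ω.2 n (A.sample n (A.state n ω))) := rfl

theorem measurable_snoc (n : ℕ) : Measurable fun p : (Fin n → Obs M K) × Obs M K =>
    (Fin.snoc (α := fun _ => Obs M K) p.1 p.2 : Fin (n + 1) → Obs M K) := by
  refine measurable_pi_iff.2 fun i => ?_
  refine Fin.lastCases ?_ (fun j => ?_) i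
  · simpa using measurable_snd
  · simpa [Function.comp_def] using (measurable_pi_apply j).comp
      (measurable_fst (α := Fin n → Obs M K) (β := Obs M K))

theorem measurable_state (n : ℕ) : Measurable (A.state n) := by
  refine measurable_fst.prodMk ?_
  induction n with
  | zero => exact measurable_pi_iff.2 fun i => i.elim0
  | succ n ih =>
    have hs : Measurable fun ω => A.sample n (A.state n ω) :=
      (A.measurable_sample n).comp (measurable_fst.prodMk ih)
    refine (measurable_snoc n).comp (ih.prodMk (hs.prodMk ?_))
    have h : Measurable fun p : (Fin M × Fin K → ℝ × ℝ) × (Fin M × Fin K) => p.1 p.2 :=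
      measurable_from_prod_countable_left fun q => measurable_pi_apply q
    exact h.comp (((measurable_pi_apply n).comp measurable_snd).prodMk hs)

theorem history_congr (s : ℝ) (n : ℕ) (y y' : ℕ → Fin M × Fin K → ℝ × ℝ)
    (h : ∀ t < n, y t = y' t) : A.history (s, y) n = A.history (s, y') n := by
  induction n with
  | zero => rfl
  | succ n ih =>
    rw [history_succ, history_succ, state, state, ih fun t ht => h t (by omega)]
    simp only [h n (by omega)]

/-- The current rewards are independent of the past. -/
theorem map_state_rewards (ζ : Market F M K) (n : ℕ) :
    (A.prob ζ).map (fun ω => (A.state n ω, ω.2 n)) =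
      ((A.prob ζ).map (A.state n)).prod (Measure.pi ζ.pairLaw) := by
  have := A.isProb
  exact map_prodMk_eval_of_past A.seedLaw (Measure.pi ζ.pairLaw) n (A.state n)
    (A.measurable_state n) fun s y y' h => by simp [state, A.history_congr s n y y' h]

/-- The pair played is random but determined by the past, which is independent of the current
rewards. With the past frozen, only the marginal of the chosen coordinate matters. -/
theorem lintegral_state_reward (ζ : Market F M K) (n : ℕ)
    (g : (ℝ × (Fin n → Obs M K)) × (ℝ × ℝ) → ℝ≥0∞) (hg : Measurable g) :
    ∫⁻ ω, g (A.state n ω, ω.2 n (A.sample n (A.state n ω))) ∂(A.prob ζ) =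
      ∫⁻ ω, ∫⁻ z, g (A.state n ω, z) ∂(ζ.pairLaw (A.sample n (A.state n ω))) ∂(A.prob ζ) := by
  have hev : Measurable fun p : (Fin M × Fin K → ℝ × ℝ) × (Fin M × Fin K) => p.1 p.2 :=
    measurable_from_prod_countable_left fun q => measurable_pi_apply q
  have hG : Measurable fun p : (ℝ × (Fin n → Obs M K)) × (Fin M × Fin K → ℝ × ℝ) =>
      g (p.1, p.2 (A.sample n p.1)) :=
    hg.comp (measurable_fst.prodMk
      (hev.comp (measurable_snd.prodMk ((A.measurable_sample n).comp measurable_fst))))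
  have hm : Measurable fun ω : Outcome M K => (A.state n ω, ω.2 n) :=
    (A.measurable_state n).prodMk ((measurable_pi_apply n).comp measurable_snd)
  rw [← lintegral_map (f := fun p : (ℝ × (Fin n → Obs M K)) × (Fin M × Fin K → ℝ × ℝ) =>
      g (p.1, p.2 (A.sample n p.1))) hG hm, map_state_rewards, lintegral_prod _ hG.aemeasurable,
    lintegral_map hG.lintegral_prod_right' (A.measurable_state n)]
  refine lintegral_congr fun ω => ?_
  exact (measurePreserving_eval ζ.pairLaw (A.sample n (A.state n ω))).lintegral_comp
    (f := fun z => g (A.state n ω, z)) (hg.comp (measurable_const.prodMk measurable_id))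

/-- The log-likelihood ratio of the first `n` observations. -/
def logLik (ζ ζ' : Market F M K) (n : ℕ) (x : ℝ × (Fin n → Obs M K)) : ℝ :=
  ∑ t, ζ.pairLlr ζ' (x.2 t).1 (x.2 t).2

theorem measurable_obs_llr (ζ ζ' : Market F M K) :
    Measurable fun o : Obs M K => ζ.pairLlr ζ' o.1 o.2 :=
  measurable_from_prod_countable_right fun q => ζ.measurable_pairLlr ζ' q

theorem measurable_logLik (ζ ζ' : Market F M K) (n : ℕ) : Measurable (logLik ζ ζ' n) := by
  unfold logLik
  exact Finset.measurable_sum _ fun t _ => (measurable_obs_llr ζ ζ').comp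
    ((measurable_pi_apply t).comp measurable_snd)

theorem measurable_nextLlr (ζ ζ' : Market F M K) (n : ℕ) :
    Measurable fun p : (ℝ × (Fin n → Obs M K)) × (ℝ × ℝ) =>
      ζ.pairLlr ζ' (A.sample n p.1) p.2 := by
  have hs : Measurable fun p : (ℝ × (Fin n → Obs M K)) × (ℝ × ℝ) => A.sample n p.1 :=
    (A.measurable_sample n).comp measurable_fst
  have h2 : Measurable fun p : (ℝ × (Fin n → Obs M K)) × (ℝ × ℝ) => (A.sample n p.1, p.2) :=
    hs.prodMk measurable_snd
  have h3 := Measurable.comp (measurable_obs_llr ζ ζ') h2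
  simpa only [Function.comp_def] using h3

/-- Change of measure between two markets along the observations. -/
theorem lintegral_state_eq (ζ ζ' : Market F M K) (n : ℕ)
    (G : ℝ × (Fin n → Obs M K) → ℝ≥0∞) (hG : Measurable G) :
    ∫⁻ ω, G (A.state n ω) ∂(A.prob ζ') =
      ∫⁻ ω, G (A.state n ω) * ENNReal.ofReal (Real.exp (-logLik ζ ζ' n (A.state n ω)))
        ∂(A.prob ζ) := by
  induction n with
  | zero =>
    have h0 : ∀ ζ'' : Market F M K, ∫⁻ ω, G (A.state 0 ω) ∂(A.prob ζ'') =
        ∫⁻ s, G (s, Fin.elim0) ∂A.seedLaw := by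
      intro ζ''
      have := A.isProb
      have hm : Measurable fun s : ℝ => G (s, Fin.elim0) :=
        hG.comp (measurable_id.prodMk measurable_const)
      unfold prob
      exact (measurePreserving_fst).lintegral_comp hm
    -- Before any round only the seed is seen, and its law does not depend on the market.
    simp [logLik, h0]
  | succ n ih =>
    let g : (ℝ × (Fin n → Obs M K)) × (ℝ × ℝ) → ℝ≥0∞ := fun p =>
      G (p.1.1, Fin.snoc (α := fun _ => Obs M K) p.1.2 (A.sample n p.1, p.2))
    have hg : Measurable g := by
      have h1 := A.measurable_sample n
      exact hG.comp ((measurable_fst.comp measurable_fst).prodMk ((measurable_snoc n).comp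
        ((measurable_snd.comp measurable_fst).prodMk
          ((h1.comp measurable_fst).prodMk measurable_snd))))
    have hg' : Measurable fun p : (ℝ × (Fin n → Obs M K)) × (ℝ × ℝ) =>
        g p * ENNReal.ofReal (Real.exp (-ζ.pairLlr ζ' (A.sample n p.1) p.2)) :=
      hg.mul (ENNReal.measurable_ofReal.comp (Real.measurable_exp.comp
        (A.measurable_nextLlr ζ ζ' n).neg))
    have hsum : ∀ ω, logLik ζ ζ' (n + 1) (A.state (n + 1) ω) =
        logLik ζ ζ' n (A.state n ω) + ζ.pairLlr ζ' (A.sample n (A.state n ω))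
          (ω.2 n (A.sample n (A.state n ω))) := by
      intro ω
      simp only [logLik, state, history_succ, Fin.sum_univ_castSucc, Fin.snoc_castSucc,
        Fin.snoc_last]
    have hL := measurable_logLik ζ ζ' n
    have hLm : Measurable fun x : ℝ × (Fin n → Obs M K) =>
      ENNReal.ofReal (Real.exp (-logLik ζ ζ' n x)) :=
      ENNReal.measurable_ofReal.comp (Real.measurable_exp.comp hL.neg)
    have hin : Measurable fun x : ℝ × (Fin n → Obs M K) => ∫⁻ z, g (x, z) *
        ENNReal.ofReal (Real.exp (-ζ.pairLlr ζ' (A.sample n x) z))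
          ∂(ζ.pairLaw (A.sample n x)) := by
      have : Measurable fun p : (ℝ × (Fin n → Obs M K)) × (Fin M × Fin K) =>
          ∫⁻ z, g (p.1, z) * ENNReal.ofReal (Real.exp (-ζ.pairLlr ζ' (A.sample n p.1) z))
            ∂(ζ.pairLaw p.2) :=
        measurable_from_prod_countable_left fun q => hg'.lintegral_prod_right' (ν := ζ.pairLaw q)
      have h2 : Measurable fun x : ℝ × (Fin n → Obs M K) => (x, A.sample n x) :=
        measurable_id.prodMk (A.measurable_sample n)
      have h3 := Measurable.comp this h2
      simpa only [Function.comp_def] using h3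
    calc ∫⁻ ω, G (A.state (n + 1) ω) ∂(A.prob ζ')
        = ∫⁻ ω, g (A.state n ω, ω.2 n (A.sample n (A.state n ω))) ∂(A.prob ζ') := rfl
      _ = ∫⁻ ω, ∫⁻ z, g (A.state n ω, z) * ENNReal.ofReal
            (Real.exp (-ζ.pairLlr ζ' (A.sample n (A.state n ω)) z))
            ∂(ζ.pairLaw (A.sample n (A.state n ω))) ∂(A.prob ζ') := by
          rw [A.lintegral_state_reward ζ' n g hg]
          refine lintegral_congr fun ω => ?_
          exact ζ.lintegral_pairLaw ζ' _ _ (hg.comp (measurable_const.prodMk measurable_id))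
      _ = ∫⁻ ω, ∫⁻ z, g (A.state n ω, z) * ENNReal.ofReal
            (Real.exp (-ζ.pairLlr ζ' (A.sample n (A.state n ω)) z)) *
              ENNReal.ofReal (Real.exp (-logLik ζ ζ' n (A.state n ω)))
            ∂(ζ.pairLaw (A.sample n (A.state n ω))) ∂(A.prob ζ) := by
          -- After integrating out the last reward, what remains is a function of the state after
          -- `n` rounds.
          rw [ih _ hin]
          refine lintegral_congr fun ω => ?_
          rw [lintegral_mul_const]
          exact hg'.comp (measurable_const.prodMk measurable_id)
      _ = ∫⁻ ω, g (A.state n ω, ω.2 n (A.sample n (A.state n ω))) * ENNReal.ofReal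
            (Real.exp (-ζ.pairLlr ζ' (A.sample n (A.state n ω))
              (ω.2 n (A.sample n (A.state n ω))))) *
              ENNReal.ofReal (Real.exp (-logLik ζ ζ' n (A.state n ω))) ∂(A.prob ζ) :=
          (A.lintegral_state_reward ζ n (fun p => g p * ENNReal.ofReal
            (Real.exp (-ζ.pairLlr ζ' (A.sample n p.1) p.2)) *
              ENNReal.ofReal (Real.exp (-logLik ζ ζ' n p.1)))
            (hg'.mul (hLm.comp measurable_fst))).symm
      _ = _ := by
          refine lintegral_congr fun ω => ?_
          rw [hsum, mul_assoc, ← ENNReal.ofReal_mul (Real.exp_pos _).le, ← Real.exp_add]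
          congr 4
          ring

end Algorithm

/-! ### Change of measure up to the truncated stopping time. -/

namespace Algorithm

variable {F : ExpFamily} {M K : ℕ} (A : Algorithm M K)

/-- This makes every earlier halting decision readable from a later state, as `runSet` requires. -/
theorem history_castLE (ω : Outcome M K) {j n : ℕ} (h : j ≤ n) :
    (fun i => A.history ω n (Fin.castLE h i)) = A.history ω j := by
  induction n, h using Nat.le_induction with
  | base => rfl
  | succ n h ih =>
    rw [← ih]
    funext i
    rw [history_succ]
    exact Fin.snoc_castSucc (α := fun _ => Obs M K) _ _ (Fin.castLE h i)

/-- The states after `n` rounds in which the algorithm did not stop before round `n`. -/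
def runSet (n : ℕ) : Set (ℝ × (Fin n → Obs M K)) :=
  {x | ∀ (j : ℕ) (hj : j < n), (x.1, fun i => x.2 (Fin.castLE hj.le i)) ∉ A.halt j}

theorem measurableSet_runSet (n : ℕ) : MeasurableSet (A.runSet n) := by
  simp only [runSet, Set.ofPred_forall]
  refine MeasurableSet.iInter fun j => MeasurableSet.iInter fun hj => ?_
  have h : Measurable fun x : ℝ × (Fin n → Obs M K) =>
      (x.1, fun i : Fin j => x.2 (Fin.castLE hj.le i)) :=
    measurable_fst.prodMk (measurable_pi_iff.2 fun i =>
      (measurable_pi_apply (Fin.castLE hj.le i)).comp measurable_snd)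
  exact (h (A.measurableSet_halt j)).compl

theorem state_mem_runSet {n : ℕ} {ω : Outcome M K} :
    A.state n ω ∈ A.runSet n ↔ ∀ j < n, A.state j ω ∉ A.halt j := by
  refine forall₂_congr fun j hj => ?_
  simp only [state, A.history_castLE ω hj.le]

theorem le_tau_iff {n : ℕ} {ω : Outcome M K} :
    (n : ℕ∞) ≤ A.tau ω ↔ A.state n ω ∈ A.runSet n := by
  rw [state_mem_runSet, tau, le_iInf₂_iff]
  constructor
  · intro h j hj hm
    exact absurd (Nat.cast_le.1 (h j hm)) (by omega)
  · intro h j hm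
    exact Nat.cast_le.2 (not_lt.1 fun hj => h j hj hm)

/-- Rounds are numbered from 0 and the halting decision after `n` rounds precedes round `n`, so this
is the event that round `n` is played. -/
theorem lt_tau_iff {n : ℕ} {ω : Outcome M K} :
    (n : ℕ∞) < A.tau ω ↔ A.state n ω ∈ A.runSet n \ A.halt n := by
  rw [← ENat.add_one_le_iff (ENat.natCast_ne_top n), ← Nat.cast_add_one, le_tau_iff,
    Set.mem_sdiff, state_mem_runSet, state_mem_runSet, Nat.forall_lt_succ_right]

theorem tau_eq_iff {n : ℕ} {ω : Outcome M K} :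
    A.tau ω = n ↔ A.state n ω ∈ A.runSet n ∩ A.halt n := by
  have h1 := A.le_tau_iff (n := n) (ω := ω)
  have h2 := A.lt_tau_iff (n := n) (ω := ω)
  rw [Set.mem_sdiff] at h2
  rw [Set.mem_inter_iff, ← h1]
  constructor
  · intro h
    refine ⟨h.ge, by_contra fun hn => ?_⟩
    exact (h2.2 ⟨h1.1 h.ge, hn⟩).ne' h
  · rintro ⟨h, hh⟩
    exact le_antisymm (not_lt.1 fun h' => (h2.1 h').2 hh) h

theorem measurableSet_lt_tau (n : ℕ) : MeasurableSet {ω | (n : ℕ∞) < A.tau ω} := by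
  simp only [lt_tau_iff]
  exact A.measurable_state n ((A.measurableSet_runSet n).diff (A.measurableSet_halt n))

/-- The event that the algorithm stops before round `n` and announces `m`. -/
def announceEvent (m : Fin M → Fin K) (n : ℕ) : Set (Outcome M K) :=
  {ω | ∃ k < n, A.tau ω = k ∧ A.announce k (A.state k ω) = m}

/-- The states after `n` rounds in which the algorithm stops and announces `m`. -/
def announceSet (m : Fin M → Fin K) (n : ℕ) : Set (ℝ × (Fin n → Obs M K)) :=
  (A.runSet n ∩ A.halt n) ∩ A.announce n ⁻¹' {m}

theorem measurableSet_announceSet (m : Fin M → Fin K) (n : ℕ) :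
    MeasurableSet (A.announceSet m n) :=
  ((A.measurableSet_runSet n).inter (A.measurableSet_halt n)).inter
    (A.measurable_announce n (measurableSet_singleton m))

theorem measurableSet_announceEvent (m : Fin M → Fin K) (n : ℕ) :
    MeasurableSet (A.announceEvent m n) := by
  have e : A.announceEvent m n = ⋃ k, ⋃ (_ : k < n), A.state k ⁻¹' A.announceSet m k := by
    ext ω
    simp [announceEvent, announceSet, tau_eq_iff, and_assoc, and_left_comm]
  rw [e]
  exact MeasurableSet.iUnion fun k => MeasurableSet.iUnion fun _ =>
    A.measurable_state k (A.measurableSet_announceSet m k)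

/-- The log-likelihood ratio of the observation of round `t`. -/
def roundLlr (ζ ζ' : Market F M K) (t : ℕ) (ω : Outcome M K) : ℝ :=
  ζ.pairLlr ζ' (A.sample t (A.state t ω)) (ω.2 t (A.sample t (A.state t ω)))

theorem logLik_state (ζ ζ' : Market F M K) (n : ℕ) (ω : Outcome M K) :
    logLik ζ ζ' n (A.state n ω) = ∑ t ∈ Finset.range n, A.roundLlr ζ ζ' t ω := by
  induction n with
  | zero => simp [logLik]
  | succ n ih =>
    rw [Finset.sum_range_succ, ← ih]
    simp only [logLik, roundLlr, state, history_succ, Fin.sum_univ_castSucc, Fin.snoc_castSucc,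
      Fin.snoc_last]

/-- The log-likelihood ratio of the observations of the first `n` rounds that are played. -/
def stoppedLlr (ζ ζ' : Market F M K) (n : ℕ) (ω : Outcome M K) : ℝ :=
  ∑ t ∈ Finset.range n, {ω | (t : ℕ∞) < A.tau ω}.indicator (A.roundLlr ζ ζ' t) ω

theorem stoppedLlr_of_tau_eq (ζ ζ' : Market F M K) {k n : ℕ} {ω : Outcome M K} (hk : k ≤ n)
    (h : A.tau ω = k) : A.stoppedLlr ζ ζ' n ω = logLik ζ ζ' k (A.state k ω) := by
  classical
  rw [logLik_state, stoppedLlr]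
  simp only [Set.indicator_apply, Set.mem_ofPred_eq, h, Nat.cast_lt]
  rw [← Finset.sum_filter]
  congr 1
  ext t
  simp only [Finset.mem_filter, Finset.mem_range]
  omega

theorem stoppedLlr_of_le_tau (ζ ζ' : Market F M K) {n : ℕ} {ω : Outcome M K}
    (h : (n : ℕ∞) ≤ A.tau ω) : A.stoppedLlr ζ ζ' n ω = logLik ζ ζ' n (A.state n ω) := by
  rw [logLik_state, stoppedLlr]
  refine Finset.sum_congr rfl fun t ht => Set.indicator_of_mem ?_ _
  exact lt_of_lt_of_le (Nat.cast_lt.2 (Finset.mem_range.1 ht)) h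

/-- The events `τ = 0, …, τ = n - 1` and `τ ≥ n` form a partition, so exactly one term survives. A
quantity at time `min(τ, n)` thus splits into functions of single states, to which the fixed-horizon
change of measure applies. -/
theorem sum_tau_cases (n : ℕ) (ω : Outcome M K) (a : ℕ → ℝ≥0∞) (b : ℝ≥0∞) :
    (∀ k < n, A.tau ω = k →
      ∑ j ∈ Finset.range n, (A.runSet j ∩ A.halt j).indicator (fun _ => a j) (A.state j ω) +
        (A.runSet n).indicator (fun _ => b) (A.state n ω) = a k) ∧
    ((n : ℕ∞) ≤ A.tau ω →
      ∑ j ∈ Finset.range n, (A.runSet j ∩ A.halt j).indicator (fun _ => a j) (A.state j ω) +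
        (A.runSet n).indicator (fun _ => b) (A.state n ω) = b) := by
  classical
  simp only [Set.indicator_apply, ← tau_eq_iff, ← le_tau_iff]
  constructor
  · intro k hk h
    simp [h, hk, hk.not_ge]
  · intro h
    rw [if_pos h, Finset.sum_eq_zero, zero_add]
    intro j hj
    refine if_neg fun h' => ?_
    rw [h', Nat.cast_le] at h
    exact absurd (Finset.mem_range.1 hj) (by omega)

/-- The change of measure up to the stopping time. -/
theorem lintegral_exp_neg_stoppedLlr (ζ ζ' : Market F M K) (m : Fin M → Fin K) (n : ℕ)
    (c : ℝ≥0∞) :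
    ∫⁻ ω, ENNReal.ofReal (Real.exp (-A.stoppedLlr ζ ζ' n ω)) *
        (1 + (A.announceEvent m n).indicator (fun _ => c) ω) ∂(A.prob ζ) =
      1 + c * A.prob ζ' (A.announceEvent m n) := by
  classical
  let g : (k : ℕ) → ℝ × (Fin k → Obs M K) → ℝ≥0∞ := fun k =>
    (A.runSet k ∩ A.halt k).indicator fun x => 1 + (A.announce k ⁻¹' {m}).indicator (fun _ => c) x
  have hg : ∀ k, Measurable (g k) := by
    intro k
    have h1 : Measurable ((A.announce k ⁻¹' {m}).indicator fun _ => c) :=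
      measurable_const.indicator (A.measurable_announce k (measurableSet_singleton m))
    exact (h1.const_add 1).indicator
      ((A.measurableSet_runSet k).inter (A.measurableSet_halt k))
  let r : ℝ × (Fin n → Obs M K) → ℝ≥0∞ := (A.runSet n).indicator fun _ => 1
  have hr : Measurable r := measurable_const.indicator (A.measurableSet_runSet n)
  have hlik : ∀ k, Measurable fun ω : Outcome M K =>
      ENNReal.ofReal (Real.exp (-logLik ζ ζ' k (A.state k ω))) := fun k =>
    ENNReal.measurable_ofReal.comp (Real.measurable_exp.comp
      ((measurable_logLik ζ ζ' k).comp (A.measurable_state k)).neg)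
  have hgs : ∀ k, Measurable fun ω => g k (A.state k ω) := fun k =>
    (hg k).comp (A.measurable_state k)
  have hrs : Measurable fun ω => r (A.state n ω) := hr.comp (A.measurable_state n)
  have hE : ∀ k < n, ∀ ω, A.tau ω = k →
      (ω ∈ A.announceEvent m n ↔ A.announce k (A.state k ω) = m) := by
    intro k hk ω h
    constructor
    · rintro ⟨j, -, hj, ha⟩
      obtain rfl : j = k := by exact_mod_cast hj.symm.trans h
      exact ha
    · exact fun ha => ⟨k, hk, h, ha⟩
  have hE' : ∀ ω, (n : ℕ∞) ≤ A.tau ω → ω ∉ A.announceEvent m n := by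
    rintro ω h ⟨j, hj, hj', -⟩
    rw [hj', Nat.cast_le] at h
    omega
  have hcases : ∀ ω, (n : ℕ∞) ≤ A.tau ω ∨ ∃ k < n, A.tau ω = k := by
    intro ω
    rcases le_or_gt (n : ℕ∞) (A.tau ω) with h | h
    · exact Or.inl h
    · obtain ⟨k, hk⟩ := ENat.ne_top_iff_exists.1 (h.trans_le le_top).ne
      exact Or.inr ⟨k, by rw [← hk] at h; exact_mod_cast h, hk.symm⟩
  -- `key1` splits the weighted integrand along the partition, `key2` the unweighted one; the change
  -- of measure matches them term by term.
  have key1 : ∀ ω, ENNReal.ofReal (Real.exp (-A.stoppedLlr ζ ζ' n ω)) *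
        (1 + (A.announceEvent m n).indicator (fun _ => c) ω) =
      ∑ k ∈ Finset.range n, g k (A.state k ω) *
          ENNReal.ofReal (Real.exp (-logLik ζ ζ' k (A.state k ω))) +
        r (A.state n ω) * ENNReal.ofReal (Real.exp (-logLik ζ ζ' n (A.state n ω))) := by
    intro ω
    have h := A.sum_tau_cases n ω (fun k => (1 + (A.announce k ⁻¹' {m}).indicator (fun _ => c)
      (A.state k ω)) * ENNReal.ofReal (Real.exp (-logLik ζ ζ' k (A.state k ω))))
      (ENNReal.ofReal (Real.exp (-logLik ζ ζ' n (A.state n ω))))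
    simp only [Set.indicator_apply, g, r, ite_mul, zero_mul, one_mul] at h ⊢
    rcases hcases ω with h' | ⟨k, hk, h'⟩
    · rw [h.2 h', A.stoppedLlr_of_le_tau ζ ζ' h', if_neg (hE' ω h'), add_zero, mul_one]
    · rw [h.1 k hk h', A.stoppedLlr_of_tau_eq ζ ζ' hk.le h', mul_comm]
      simp only [hE k hk ω h', Set.mem_preimage, Set.mem_singleton_iff]
  have key2 : ∀ ω, 1 + (A.announceEvent m n).indicator (fun _ => c) ω =
      ∑ k ∈ Finset.range n, g k (A.state k ω) + r (A.state n ω) := by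
    intro ω
    have h := A.sum_tau_cases n ω (fun k => 1 + (A.announce k ⁻¹' {m}).indicator (fun _ => c)
      (A.state k ω)) 1
    simp only [Set.indicator_apply, g, r] at h ⊢
    rcases hcases ω with h' | ⟨k, hk, h'⟩
    · rw [h.2 h', if_neg (hE' ω h'), add_zero]
    · rw [h.1 k hk h']
      simp only [hE k hk ω h', Set.mem_preimage, Set.mem_singleton_iff]
  calc _ = ∑ k ∈ Finset.range n, ∫⁻ ω, g k (A.state k ω) *
          ENNReal.ofReal (Real.exp (-logLik ζ ζ' k (A.state k ω))) ∂(A.prob ζ) +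
        ∫⁻ ω, r (A.state n ω) * ENNReal.ofReal (Real.exp (-logLik ζ ζ' n (A.state n ω)))
          ∂(A.prob ζ) := by
        rw [lintegral_congr key1, lintegral_add_right (g := fun ω => r (A.state n ω) *
            ENNReal.ofReal (Real.exp (-logLik ζ ζ' n (A.state n ω)))) _ (hrs.mul (hlik n)),
          lintegral_finsetSum (f := fun k ω => g k (A.state k ω) *
            ENNReal.ofReal (Real.exp (-logLik ζ ζ' k (A.state k ω)))) _
            fun k _ => (hgs k).mul (hlik k)]
    _ = ∑ k ∈ Finset.range n, ∫⁻ ω, g k (A.state k ω) ∂(A.prob ζ') +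
        ∫⁻ ω, r (A.state n ω) ∂(A.prob ζ') := by
        rw [← A.lintegral_state_eq ζ ζ' n r hr]
        congr 1
        exact Finset.sum_congr rfl fun k _ => (A.lintegral_state_eq ζ ζ' k (g k) (hg k)).symm
    _ = ∫⁻ ω, 1 + (A.announceEvent m n).indicator (fun _ => c) ω ∂(A.prob ζ') := by
        rw [lintegral_congr key2, lintegral_add_right _ hrs,
          lintegral_finsetSum _ fun k _ => hgs k]
    _ = _ := by
        rw [lintegral_add_left measurable_const,
          lintegral_indicator_const (A.measurableSet_announceEvent m n)]
        simp

/-! ### Expected information and expected numbers of plays. -/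

/-- The probability that the pair `q` is played in round `t`. -/
def playProb (ζ : Market F M K) (t : ℕ) (q : Fin M × Fin K) : ℝ :=
  (A.prob ζ).real {ω | (t : ℕ∞) < A.tau ω ∧ A.sample t (A.state t ω) = q}

theorem measurableSet_play (t : ℕ) (q : Fin M × Fin K) :
    MeasurableSet {ω | (t : ℕ∞) < A.tau ω ∧ A.sample t (A.state t ω) = q} :=
  (A.measurableSet_lt_tau t).inter
    ((A.measurable_sample t).comp (A.measurable_state t) (measurableSet_singleton q))

theorem measurePreserving_reward (ζ : Market F M K) (t : ℕ) (q : Fin M × Fin K) :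
    MeasurePreserving (fun ω : Outcome M K => ω.2 t q) (A.prob ζ) (ζ.pairLaw q) := by
  have := A.isProb
  exact (measurePreserving_eval ζ.pairLaw q).comp
    ((measurePreserving_eval_infinitePi (fun _ : ℕ => Measure.pi ζ.pairLaw) t).comp
      (measurePreserving_snd (μ := A.seedLaw)))

theorem indepFun_state_rewards (ζ : Market F M K) (t : ℕ) :
    IndepFun (A.state t) (fun ω : Outcome M K => ω.2 t) (A.prob ζ) := by
  have := A.isProb
  have hm : Measurable fun ω : Outcome M K => ω.2 t := (measurable_pi_apply t).comp measurable_snd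
  rw [indepFun_iff_map_prod_eq_prod_map_map (A.measurable_state t).aemeasurable hm.aemeasurable,
    map_state_rewards]
  congr 1
  exact ((measurePreserving_eval_infinitePi (fun _ : ℕ => Measure.pi ζ.pairLaw) t).comp
      (measurePreserving_snd (μ := A.seedLaw))).map_eq.symm

/-- Whether `q` is played in round `t` is decided by the past, hence independent of the rewards of
round `t`, and the expectation factorises. -/
theorem integral_play_llr (ζ ζ' : Market F M K) (t : ℕ) (q : Fin M × Fin K) :
    Integrable ({ω | (t : ℕ∞) < A.tau ω ∧ A.sample t (A.state t ω) = q}.indicator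
      fun ω => ζ.pairLlr ζ' q (ω.2 t q)) (A.prob ζ) ∧
    ∫ ω, {ω | (t : ℕ∞) < A.tau ω ∧ A.sample t (A.state t ω) = q}.indicator
      (fun ω => ζ.pairLlr ζ' q (ω.2 t q)) ω ∂(A.prob ζ) =
        A.playProb ζ t q * ζ.pairDiv ζ' q := by
  have hmp := A.measurePreserving_reward ζ t q
  have hint : Integrable (fun ω : Outcome M K => ζ.pairLlr ζ' q (ω.2 t q)) (A.prob ζ) :=
    hmp.integrable_comp_of_integrable (ζ.integrable_pairLlr ζ' q)
  have hval : ∫ ω, ζ.pairLlr ζ' q (ω.2 t q) ∂(A.prob ζ) = ζ.pairDiv ζ' q := by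
    rw [← ζ.integral_pairLlr ζ' q, ← hmp.map_eq, integral_map hmp.measurable.aemeasurable
      (ζ.measurable_pairLlr ζ' q).aestronglyMeasurable]
  refine ⟨hint.indicator (A.measurableSet_play t q), ?_⟩
  let S : Set (ℝ × (Fin t → Obs M K)) := (A.runSet t \ A.halt t) ∩ A.sample t ⁻¹' {q}
  have hS : MeasurableSet S := ((A.measurableSet_runSet t).diff (A.measurableSet_halt t)).inter
    (A.measurable_sample t (measurableSet_singleton q))
  have hset : {ω | (t : ℕ∞) < A.tau ω ∧ A.sample t (A.state t ω) = q} = A.state t ⁻¹' S := by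
    ext ω
    simp [S, lt_tau_iff]
  have hφ : Measurable (S.indicator fun _ => (1 : ℝ)) := measurable_const.indicator hS
  have hψ : Measurable fun y : Fin M × Fin K → ℝ × ℝ => ζ.pairLlr ζ' q (y q) :=
    (ζ.measurable_pairLlr ζ' q).comp (measurable_pi_apply q)
  have hind := (A.indepFun_state_rewards ζ t).comp hφ hψ
  have hmul := hind.integral_mul_eq_mul_integral
    (hφ.comp (A.measurable_state t)).aestronglyMeasurable hint.aestronglyMeasurable
  have h1 : ∫ ω, ((S.indicator fun _ => (1 : ℝ)) ∘ A.state t) ω ∂(A.prob ζ) =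
      A.playProb ζ t q := by
    rw [playProb, hset, ← integral_indicator_one (A.measurable_state t hS)]
    rfl
  rw [h1] at hmul
  rw [← hval, hset]
  refine Eq.trans (integral_congr_ae (ae_of_all _ fun ω => ?_)) hmul
  by_cases h : A.state t ω ∈ S
  · simp [h]
  · simp [h]

theorem indicator_roundLlr (ζ ζ' : Market F M K) (t : ℕ) (ω : Outcome M K) :
    {ω | (t : ℕ∞) < A.tau ω}.indicator (A.roundLlr ζ ζ' t) ω =
      ∑ q, {ω | (t : ℕ∞) < A.tau ω ∧ A.sample t (A.state t ω) = q}.indicator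
        (fun ω => ζ.pairLlr ζ' q (ω.2 t q)) ω := by
  classical
  by_cases h : (t : ℕ∞) < A.tau ω
  · simp [Set.indicator_apply, h, roundLlr]
  · simp [h]

theorem integrable_stoppedLlr (ζ ζ' : Market F M K) (n : ℕ) :
    Integrable (A.stoppedLlr ζ ζ' n) (A.prob ζ) := by
  have e : A.stoppedLlr ζ ζ' n = fun ω => ∑ t ∈ Finset.range n, ∑ q,
      {ω | (t : ℕ∞) < A.tau ω ∧ A.sample t (A.state t ω) = q}.indicator
        (fun ω => ζ.pairLlr ζ' q (ω.2 t q)) ω := by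
    funext ω
    simp only [stoppedLlr, indicator_roundLlr]
  rw [e]
  exact integrable_finsetSum _ fun t _ => integrable_finsetSum _ fun q _ =>
    (A.integral_play_llr ζ ζ' t q).1

/-- Wald's identity at the truncated time, obtained by summing over rounds and pairs. -/
theorem integral_stoppedLlr (ζ ζ' : Market F M K) (n : ℕ) :
    ∫ ω, A.stoppedLlr ζ ζ' n ω ∂(A.prob ζ) =
      ∑ q, (∑ t ∈ Finset.range n, A.playProb ζ t q) * ζ.pairDiv ζ' q := by
  simp only [stoppedLlr, indicator_roundLlr]
  rw [integral_finsetSum _ fun t _ => integrable_finsetSum _ fun q _ =>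
    (A.integral_play_llr ζ ζ' t q).1]
  simp only [Finset.sum_mul]
  rw [Finset.sum_comm]
  refine Finset.sum_congr rfl fun t _ => ?_
  rw [integral_finsetSum _ fun q _ => (A.integral_play_llr ζ ζ' t q).1]
  exact Finset.sum_congr rfl fun q _ => (A.integral_play_llr ζ ζ' t q).2

/-- Each played round uses exactly one pair, so the counts add up to `min(τ, n) ≤ τ`. -/
theorem sum_playProb_le (ζ : Market F M K) (n : ℕ) :
    ENNReal.ofReal (∑ q, ∑ t ∈ Finset.range n, A.playProb ζ t q) ≤ A.expectedTau ζ := by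
  classical
  have hpt : ∀ ω, ∑ q, ∑ t ∈ Finset.range n,
      {ω | (t : ℕ∞) < A.tau ω ∧ A.sample t (A.state t ω) = q}.indicator
        (fun _ => (1 : ℝ≥0∞)) ω ≤ (A.tau ω : ℝ≥0∞) := by
    intro ω
    rw [Finset.sum_comm]
    have e : ∀ t : ℕ, ∑ q, {ω | (t : ℕ∞) < A.tau ω ∧ A.sample t (A.state t ω) = q}.indicator
        (fun _ => (1 : ℝ≥0∞)) ω = if (t : ℕ∞) < A.tau ω then 1 else 0 := by
      intro t
      by_cases h : (t : ℕ∞) < A.tau ω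
      · simp [Set.indicator_apply, h]
      · simp [h]
    simp only [e]
    by_cases h : A.tau ω = ⊤
    · simp [h]
    · obtain ⟨N, hN⟩ := ENat.ne_top_iff_exists.1 h
      rw [← hN, ENat.toENNReal_coe]
      simp only [Nat.cast_lt, Finset.sum_boole, Nat.cast_le]
      calc _ ≤ (Finset.range N).card := Finset.card_le_card fun t ht => by simp_all
        _ = N := Finset.card_range N
  calc _ = ∑ q, ∑ t ∈ Finset.range n, A.prob ζ
        {ω | (t : ℕ∞) < A.tau ω ∧ A.sample t (A.state t ω) = q} := by
        simp only [playProb]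
        rw [ENNReal.ofReal_sum_of_nonneg fun q _ => Finset.sum_nonneg fun t _ => measureReal_nonneg]
        refine Finset.sum_congr rfl fun q _ => ?_
        rw [ENNReal.ofReal_sum_of_nonneg fun t _ => measureReal_nonneg]
        exact Finset.sum_congr rfl fun t _ => ofReal_measureReal
    _ = ∫⁻ ω, ∑ q, ∑ t ∈ Finset.range n,
      {ω | (t : ℕ∞) < A.tau ω ∧ A.sample t (A.state t ω) = q}.indicator
        (fun _ => (1 : ℝ≥0∞)) ω ∂(A.prob ζ) := by
        have hm : ∀ q (t : ℕ), Measurable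
            ({ω | (t : ℕ∞) < A.tau ω ∧ A.sample t (A.state t ω) = q}.indicator
              (fun _ => (1 : ℝ≥0∞))) := fun q t =>
          measurable_const.indicator (A.measurableSet_play t q)
        rw [lintegral_finsetSum _ fun q _ => Finset.measurable_sum _ fun t _ => hm q t]
        refine Finset.sum_congr rfl fun q _ => ?_
        rw [lintegral_finsetSum _ fun t _ => hm q t]
        refine Finset.sum_congr rfl fun t _ => ?_
        rw [lintegral_indicator_const (A.measurableSet_play t q), one_mul]
    _ ≤ _ := lintegral_mono hpt

/-! ### The transportation inequality. -/

/-- Transportation inequality: distinguishing two markets by the announcement of `m` requires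
information. -/
theorem log_le_sum_playProb (ζ ζ' : Market F M K) (m : Fin M → Fin K) (n : ℕ) {δ : ℝ}
    (hδ : 0 < δ) (h : A.prob ζ' (A.announceEvent m n) ≤ ENNReal.ofReal δ) :
    (A.prob ζ).real (A.announceEvent m n) * Real.log (1 / δ) - Real.log 2 ≤
      ∑ q, (∑ t ∈ Finset.range n, A.playProb ζ t q) * ζ.pairDiv ζ' q := by
  set E := A.announceEvent m n
  have hEm : MeasurableSet E := A.measurableSet_announceEvent m n
  set P := A.prob ζ
  have hL := A.integrable_stoppedLlr ζ ζ' n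
  -- The exponent for Jensen's inequality; `log 2` normalises the bound `1 + P_ζ'(E)/δ ≤ 2`, so that
  -- `exp x` has integral at most 1.
  let x : Outcome M K → ℝ := fun ω =>
    E.indicator (fun _ => Real.log (1 / δ)) ω - A.stoppedLlr ζ ζ' n ω - Real.log 2
  have hI : Integrable (E.indicator fun _ => Real.log (1 / δ)) P :=
    (integrable_const _).indicator hEm
  have hx : Integrable x P := (hI.sub hL).sub (integrable_const _)
  have hxint : ∫ ω, x ω ∂P = P.real E * Real.log (1 / δ) -
      ∑ q, (∑ t ∈ Finset.range n, A.playProb ζ t q) * ζ.pairDiv ζ' q - Real.log 2 := by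
    simp only [x]
    rw [integral_sub (f := fun ω => E.indicator (fun _ => Real.log (1 / δ)) ω -
      A.stoppedLlr ζ ζ' n ω) (hI.sub hL) (integrable_const _), integral_sub hI hL,
      integral_indicator_const _ hEm, A.integral_stoppedLlr ζ ζ' n]
    simp
  have hle : ∫⁻ ω, ENNReal.ofReal (Real.exp (x ω)) ∂P ≤ 1 := by
    -- The factor `exp(1_E log(1/δ))` is `1/δ` on `E` and 1 elsewhere, hence at most `1 + 1_E/δ`.
    have hpt : ∀ ω, ENNReal.ofReal (Real.exp (x ω)) ≤ 2⁻¹ *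
        (ENNReal.ofReal (Real.exp (-A.stoppedLlr ζ ζ' n ω)) *
          (1 + E.indicator (fun _ => ENNReal.ofReal (1 / δ)) ω)) := by
      intro ω
      have h2 : Real.exp (x ω) = 2⁻¹ * (Real.exp (-A.stoppedLlr ζ ζ' n ω) *
          Real.exp (E.indicator (fun _ => Real.log (1 / δ)) ω)) := by
        rw [← Real.exp_add, ← Real.exp_log (show (0 : ℝ) < 2⁻¹ by norm_num), ← Real.exp_add,
          Real.log_inv]
        congr 1
        simp only [x]
        ring
      rw [h2, ENNReal.ofReal_mul (by norm_num), ENNReal.ofReal_mul (Real.exp_pos _).le,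
        ENNReal.ofReal_inv_of_pos two_pos, ENNReal.ofReal_ofNat]
      gcongr
      by_cases hω : ω ∈ E
      · simp only [Set.indicator_of_mem hω]
        rw [Real.exp_log (by positivity)]
        exact le_add_self
      · simp [Set.indicator_of_notMem hω]
    calc _ ≤ _ := lintegral_mono hpt
      _ = 2⁻¹ * (1 + ENNReal.ofReal (1 / δ) * A.prob ζ' E) := by
        rw [lintegral_const_mul' _ _ (by simp), A.lintegral_exp_neg_stoppedLlr ζ ζ' m n]
      _ ≤ 2⁻¹ * (1 + ENNReal.ofReal (1 / δ) * ENNReal.ofReal δ) := by gcongr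
      _ = 1 := by
        rw [← ENNReal.ofReal_mul (by positivity), one_div_mul_cancel hδ.ne', ENNReal.ofReal_one,
          one_add_one_eq_two, ENNReal.inv_mul_cancel (by simp) (by simp)]
  have hem : AEStronglyMeasurable (fun ω => Real.exp (x ω)) P :=
    Real.continuous_exp.comp_aestronglyMeasurable hx.aestronglyMeasurable
  have hei : Integrable (fun ω => Real.exp (x ω)) P := by
    refine (lintegral_ofReal_ne_top_iff_integrable hem (ae_of_all _ fun ω =>
      (Real.exp_pos _).le)).1 (hle.trans_lt ENNReal.one_lt_top).ne
  have h1 : ∫ ω, Real.exp (x ω) ∂P ≤ 1 := by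
    rw [integral_eq_lintegral_of_nonneg_ae (ae_of_all _ fun ω => (Real.exp_pos _).le) hem]
    exact ENNReal.toReal_le_of_le_ofReal zero_le_one (by simpa using hle)
  -- Jensen in the form `x + 1 ≤ exp x`: the integral of `x` is at most 0.
  have h2 : ∫ ω, (x ω + 1) ∂P ≤ ∫ ω, Real.exp (x ω) ∂P :=
    integral_mono (hx.add (integrable_const _)) hei fun ω => Real.add_one_le_exp _
  rw [integral_add hx (integrable_const _), hxint] at h2
  simp at h2
  simp only [one_div, Real.log_inv] at h2 ⊢
  linarith

end Algorithm

/-! ### The optimisation over sampling proportions. -/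

namespace Market

variable {F : ExpFamily} {M K : ℕ}

theorem info_eq (ζ : Market F M K) (m : Fin M → Fin K) (w : Fin M × Fin K → ℝ) :
    ζ.info m w = ⨅ ζ' ∈ alternatives F m, ENNReal.ofReal (∑ q, w q * ζ.pairDiv ζ' q) := by
  simp only [info, pairDiv, Fintype.sum_prod_type]

theorem upperSemicontinuous_info (ζ : Market F M K) (m : Fin M → Fin K) :
    UpperSemicontinuous (ζ.info m) := by
  rw [show ζ.info m = fun w => _ from funext (ζ.info_eq m)]
  refine upperSemicontinuous_biInf fun ζ' _ => Continuous.upperSemicontinuous ?_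
  exact ENNReal.continuous_ofReal.comp (by fun_prop)

theorem exists_info_eq_D (hM : 1 ≤ M) (hMK : M ≤ K) (ζ : Market F M K) (m : Fin M → Fin K) :
    ∃ w ∈ stdSimplex ℝ (Fin M × Fin K), ζ.info m w = ζ.D m := by
  have hne : (stdSimplex ℝ (Fin M × Fin K)).Nonempty :=
    ⟨_, single_mem_stdSimplex ℝ ((⟨0, hM⟩, ⟨0, hM.trans hMK⟩) : Fin M × Fin K)⟩
  obtain ⟨w, hw, hmax⟩ := ((ζ.upperSemicontinuous_info m).upperSemicontinuousOn _).exists_isMaxOn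
    hne (isCompact_stdSimplex ℝ (Fin M × Fin K))
  exact ⟨w, hw, le_antisymm (le_iSup₂ (f := fun w _ => ζ.info m w) w hw)
    (iSup₂_le fun w' hw' => hmax hw')⟩

/-- The information gathered by nonnegative sampling numbers `c` is at most `D` times their sum. -/
theorem le_sum_mul_D (ζ : Market F M K) (m : Fin M → Fin K) (hne : (alternatives F m).Nonempty)
    (c : Fin M × Fin K → ℝ) (hc : ∀ q, 0 ≤ c q) (κ : ℝ)
    (h : ∀ ζ' ∈ alternatives F m, κ ≤ ∑ q, c q * ζ.pairDiv ζ' q) :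
    ENNReal.ofReal κ ≤ ENNReal.ofReal (∑ q, c q) * ζ.D m := by
  rcases le_or_gt κ 0 with hκ | hκ
  · simp [ENNReal.ofReal_of_nonpos hκ]
  -- With no plays at all, any one alternative would force `κ ≤ 0`.
  have hS : 0 < ∑ q, c q := by
    refine (Finset.sum_nonneg fun q _ => hc q).lt_of_ne' fun h0 => ?_
    obtain ⟨ζ', hζ'⟩ := hne
    have hz := (Finset.sum_eq_zero_iff_of_nonneg fun q _ => hc q).1 h0
    have := h ζ' hζ'
    rw [Finset.sum_eq_zero fun q hq => by rw [hz q hq, zero_mul]] at this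
    linarith
  set S := ∑ q, c q
  have hw : (fun q => c q / S) ∈ stdSimplex ℝ (Fin M × Fin K) :=
    ⟨fun q => div_nonneg (hc q) hS.le, by rw [← Finset.sum_div, div_self hS.ne']⟩
  have hD : ENNReal.ofReal (κ / S) ≤ ζ.D m := by
    refine le_trans ?_ (le_iSup₂ (f := fun w _ => ζ.info m w) _ hw)
    rw [info_eq]
    refine le_iInf₂ fun ζ' hζ' => ENNReal.ofReal_le_ofReal ?_
    simp only [div_mul_eq_mul_div, ← Finset.sum_div]
    exact div_le_div_of_nonneg_right (h ζ' hζ') hS.le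
  calc ENNReal.ofReal κ = ENNReal.ofReal S * ENNReal.ofReal (κ / S) := by
        rw [← ENNReal.ofReal_mul hS.le, mul_div_cancel₀ _ hS.ne']
    _ ≤ _ := by gcongr

end Market

/-! ### From correctness to the bound at fixed `δ`. -/

namespace Algorithm

variable {F : ExpFamily} {M K : ℕ} (A : Algorithm M K)

theorem prob_announceEvent_le {δ : ℝ} (hA : A.IsCorrect F δ) (m : Fin M → Fin K)
    (ζ' : Market F M K) (hζ' : ζ' ∈ Market.alternatives F m) (n : ℕ) :
    A.prob ζ' (A.announceEvent m n) ≤ ENNReal.ofReal δ := by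
  refine (measure_mono ?_).trans (hA ζ')
  rintro ω ⟨k, -, hk, ha⟩
  refine ⟨k, hk, ?_⟩
  have ha' : A.announce k (ω.1, A.history ω k) = m := ha
  rw [ha']
  exact hζ'

theorem prob_tau_eq_top (ζ : Market F M K) (hT : A.expectedTau ζ ≠ ⊤) :
    A.prob ζ {ω | A.tau ω = ⊤} = 0 := by
  have hm : MeasurableSet {ω | A.tau ω = ⊤} := by
    have e : {ω | A.tau ω = ⊤} = ⋂ n : ℕ, {ω | (n : ℕ∞) < A.tau ω} := by
      ext ω
      simp only [Set.mem_iInter, Set.mem_ofPred_eq]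
      exact ENat.eq_top_iff_forall_gt
    rw [e]
    exact MeasurableSet.iInter A.measurableSet_lt_tau
  have h : ⊤ * A.prob ζ {ω | A.tau ω = ⊤} ≤ A.expectedTau ζ := by
    rw [← lintegral_indicator_const hm]
    refine lintegral_mono fun ω => ?_
    by_cases hω : A.tau ω = ⊤
    · simp [hω]
    · simp [hω]
  by_contra h0
  rw [ENNReal.top_mul h0] at h
  exact hT (top_le_iff.1 h)

/-- Failing to announce `m` means never stopping, a null event since `E[τ]` is finite, or announcing
a matching that, by uniqueness, is not stable. -/
theorem one_sub_le_prob_announceEvent {δ : ℝ} (hδ : 0 ≤ δ) (hA : A.IsCorrect F δ)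
    (ζ : Market F M K) (m : Fin M → Fin K) (hm : ζ.IsUniqueStable m)
    (hT : A.expectedTau ζ ≠ ⊤) :
    1 - δ ≤ (A.prob ζ).real (⋃ n, A.announceEvent m n) := by
  have hmeas : MeasurableSet (⋃ n, A.announceEvent m n) :=
    MeasurableSet.iUnion (A.measurableSet_announceEvent m)
  have hsub : (⋃ n, A.announceEvent m n)ᶜ ⊆
      {ω | ∃ n : ℕ, A.tau ω = n ∧ ¬ ζ.IsStable (A.announce n (ω.1, A.history ω n))} ∪
        {ω | A.tau ω = ⊤} := by
    intro ω hω
    by_cases h : A.tau ω = ⊤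
    · exact Or.inr h
    · obtain ⟨n, hn⟩ := ENat.ne_top_iff_exists.1 h
      refine Or.inl ⟨n, hn.symm, fun hs => hω ?_⟩
      -- The index is `n + 1` because `announceEvent` asks for stopping strictly before its horizon.
      exact Set.mem_iUnion.2 ⟨n + 1, n, n.lt_succ_self, hn.symm, hm.2 _ hs⟩
  have h1 : A.prob ζ (⋃ n, A.announceEvent m n)ᶜ ≤ ENNReal.ofReal δ := by
    refine (measure_mono hsub).trans ((measure_union_le _ _).trans ?_)
    rw [A.prob_tau_eq_top ζ hT, add_zero]
    exact hA ζ
  have h2 : (A.prob ζ).real (⋃ n, A.announceEvent m n)ᶜ ≤ δ :=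
    ENNReal.toReal_le_of_le_ofReal hδ h1
  rw [probReal_compl_eq_one_sub hmeas] at h2
  linarith

/-- The sample complexity of a correct algorithm at confidence `δ`. -/
theorem log_le_expectedTau_mul_D {δ : ℝ} (hδ : δ ∈ Set.Ioo (0 : ℝ) 1) (hA : A.IsCorrect F δ)
    (ζ : Market F M K) (m : Fin M → Fin K) (hm : ζ.IsUniqueStable m)
    (hne : (Market.alternatives F m).Nonempty) (hT : A.expectedTau ζ ≠ ⊤) :
    ENNReal.ofReal ((1 - δ) * Real.log (1 / δ) - Real.log 2) ≤ A.expectedTau ζ * ζ.D m := by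
  have hn : ∀ n, ENNReal.ofReal ((A.prob ζ).real (A.announceEvent m n) * Real.log (1 / δ) -
      Real.log 2) ≤ A.expectedTau ζ * ζ.D m := by
    intro n
    refine (ζ.le_sum_mul_D m hne (fun q => ∑ t ∈ Finset.range n, A.playProb ζ t q)
      (fun q => Finset.sum_nonneg fun t _ => measureReal_nonneg) _ fun ζ' hζ' =>
        A.log_le_sum_playProb ζ ζ' m n hδ.1 (A.prob_announceEvent_le hA m ζ' hζ' n)).trans ?_
    gcongr
    exact A.sum_playProb_le ζ n
  have hmono : Monotone (A.announceEvent m) := fun a b hab ω ⟨k, hk, h⟩ =>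
    ⟨k, hk.trans_le hab, h⟩
  have hlim : Tendsto (fun n => (A.prob ζ).real (A.announceEvent m n)) atTop
      (𝓝 ((A.prob ζ).real (⋃ n, A.announceEvent m n))) :=
    (ENNReal.tendsto_toReal (measure_ne_top _ _)).comp (tendsto_measure_iUnion_atTop hmono)
  have hlim' := ENNReal.tendsto_ofReal ((hlim.mul_const (Real.log (1 / δ))).sub_const (Real.log 2))
  refine le_trans (ENNReal.ofReal_le_ofReal ?_) (le_of_tendsto' hlim' hn)
  have hlog : 0 ≤ Real.log (1 / δ) := Real.log_nonneg (by
    rw [le_div_iff₀ hδ.1]; linarith [hδ.2])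
  gcongr
  exact A.one_sub_le_prob_announceEvent hδ.1.le hA ζ m hm hT

end Algorithm

/-! ### The limit of small `δ`. -/

theorem tendsto_log_one_div_nhdsGT_zero :
    Tendsto (fun δ : ℝ => Real.log (1 / δ)) (𝓝[>] 0) atTop := by
  simp only [one_div]
  exact Real.tendsto_log_atTop.comp tendsto_inv_nhdsGT_zero

theorem mainTheorem6 (F : ExpFamily) {M K : ℕ} (hM : 1 ≤ M) (hMK : M ≤ K)
    (ζ : Market F M K) (m : Fin M → Fin K) (hm : ζ.IsUniqueStable m) :
    (∃ w ∈ stdSimplex ℝ (Fin M × Fin K), ζ.info m w = ζ.D m) ∧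
    ∀ A : ℝ → Algorithm M K, (∀ δ ∈ Set.Ioo (0 : ℝ) 1, (A δ).IsCorrect F δ) →
      ζ.Tstar m ≤ liminf (fun δ : ℝ => (A δ).expectedTau ζ / ENNReal.ofReal (Real.log (1 / δ)))
        (𝓝[>] (0 : ℝ)) := by
  refine ⟨Market.exists_info_eq_D hM hMK ζ m, fun A hA => ?_⟩
  rcases (Market.alternatives F m).eq_empty_or_nonempty with hempty | hne
  -- Without alternatives the infimum is `∞`, so `D = ∞` and the bound is 0.
  · obtain ⟨w, -, hw⟩ := Market.exists_info_eq_D hM hMK ζ m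
    rw [Market.info_eq, hempty] at hw
    simp [Market.Tstar, ← hw]
  have hlog := tendsto_log_one_div_nhdsGT_zero
  have hδ0 : Tendsto (fun δ : ℝ => δ) (𝓝[>] 0) (𝓝 0) :=
    tendsto_nhdsWithin_of_tendsto_nhds tendsto_id
  have hrate : Tendsto (fun δ : ℝ => ζ.Tstar m *
      ENNReal.ofReal ((1 - δ) - Real.log 2 / Real.log (1 / δ))) (𝓝[>] 0) (𝓝 (ζ.Tstar m)) := by
    have h1 := (hδ0.const_sub 1).sub (hlog.const_div_atTop (Real.log 2))
    -- `Tstar` may be `∞`; multiplication by it is still continuous at the limit 1 of the other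
    -- factor, which is not 0.
    have h2 := ENNReal.Tendsto.const_mul (a := ζ.Tstar m) (ENNReal.tendsto_ofReal h1)
      (Or.inl (by simp))
    simpa using h2
  rw [← hrate.liminf_eq]
  refine liminf_le_liminf ?_
  filter_upwards [Ioo_mem_nhdsGT (zero_lt_one' ℝ)] with δ hδ
  have hl : 0 < Real.log (1 / δ) := Real.log_pos (by rw [lt_div_iff₀ hδ.1]; linarith [hδ.2])
  have hκ : (1 - δ) - Real.log 2 / Real.log (1 / δ) =
      ((1 - δ) * Real.log (1 / δ) - Real.log 2) / Real.log (1 / δ) := by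
    rw [sub_div, mul_div_cancel_right₀ _ hl.ne']
  rw [hκ, ENNReal.ofReal_div_of_pos hl, ← mul_div_assoc]
  refine ENNReal.div_le_div_right ?_ _
  by_cases hT : (A δ).expectedTau ζ = ⊤
  · simp [hT]
  · rw [Market.Tstar, mul_comm, ← div_eq_mul_inv]
    exact ENNReal.div_le_of_le_mul ((A δ).log_le_expectedTau_mul_D hδ (hA δ hδ) ζ m hm hne hT)

end
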